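/- A triple of integers $(m,n,k)$ denotes the binary quadratic form $f(x,y)=mx^2+ny^2+kxy$, of discriminant $\Delta=k^2-4mn$, and $C(m,n,k)$ denotes its class, i.e. its orbit under the substitutions $(x,y)\mapsto(ax+by,\,cx+dy)$ with $\begin{pmatrix}a&b\\c&d\end{pmatrix}\in \mathrm{SL}(2,\mathbb Z)$. With $\mathbf f=(m,n,k)$ the class always contains the complementary form $(n,m,-k)$. Consider also the conjugate form $\overline{\mathbf f}=(m,n,-k)$, the adjoint form $\mathbf f^*=(-n,-m,k)$ and the antipodal form $\overline{\mathbf f}^*=(-n,-m,-k)$. A class $C$ is called - asymmetric if for every $\mathbf f\in C$ none of the conjugate, adjoint and antipodal forms of $\mathbf f$ is in $C$; - $k$-symmetric if for every $\mathbf f\in C$ the conjugate form is in $C$ but the adjoint and antipodal forms are not; - $(m+n)$-symmetric if for every $\mathbf f\in C$ the adjoint form is in $C$ but the conjugate and antipodal forms are not; - antisymmetric if for every $\mathbf f\in C$ the antipodal form is in $C$ but the conjugate and adjoint forms are not; - supersymmetric if for every $\mathbf f\in C$ the conjugate, adjoint and antipodal forms are all in $C$. For a rational $r>1$ let $r=[a_1,\dots,a_N]=a_1+\cfrac{1}{a_2+\cdots+\cfrac1{a_N}}$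 with positive integers $a_i$ and $a_N>1$. The odd (respectively even) continued fraction of $r$ is $[a_1,\dots,a_N]$ if $N$ is odd (respectively even), and $[a_1,\dots,a_{N-1},a_N-1,1]$ otherwise. A finite continued fraction is palindromic if it reads the same backwards and forwards. **Theorem.** Let $m,k$ be integers with $0\le m<|k|$, so that $(m,0,k)$ has discriminant $\Delta=k^2$. (i) $C(m,0,k)$ is supersymmetric if and only if $m=0$, or $k$ is even and $m=|k|/2$ (in the latter case $\Delta$ is divisible by $4$). (ii) If $m\neq 0$ and $m\ne |k|/2$, then $C(m,0,k)$ is $(m+n)$-symmetric if and only if the even continued fraction of $|k|/m$ is palindromic. (iii) If $m\neq 0$ and $m\ne |k|/2$, then $C(m,0,k)$ is $k$-symmetric if and only if the odd continued fraction of $|k|/m$ is palindromic. (iv) $C(m,0,k)$ is never antisymmetric. (v) If $m\ne0$, then $C(m,0,k)$ is asymmetric if and only if neither the odd nor the even continued fraction of $|k|/m$ is palindromic. -/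

import Mathlib

/-- The integer binary quadratic form `m x² + n y² + k x y`, written as the triple `(m, n, k)`. -/
@[ext]
structure BForm where
  m : ℤ
  n : ℤ
  k : ℤ

namespace BForm

/-- The value `m x² + n y² + k x y`. -/
def eval (f : BForm) (x y : ℤ) : ℤ := f.m * x ^ 2 + f.n * y ^ 2 + f.k * (x * y)

/-- The discriminant `k² - 4 m n`. -/
def disc (f : BForm) : ℤ := f.k ^ 2 - 4 * f.m * f.n

/-- The form `(x, y) ↦ f (S₀₀ x + S₀₁ y, S₁₀ x + S₁₁ y)`, see `eval_subst`. -/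
def subst (f : BForm) (S : Matrix.SpecialLinearGroup (Fin 2) ℤ) : BForm where
  m := f.m * S 0 0 ^ 2 + f.n * S 1 0 ^ 2 + f.k * (S 0 0 * S 1 0)
  n := f.m * S 0 1 ^ 2 + f.n * S 1 1 ^ 2 + f.k * (S 0 1 * S 1 1)
  k := 2 * f.m * (S 0 0 * S 0 1) + 2 * f.n * (S 1 0 * S 1 1)
        + f.k * (S 0 0 * S 1 1 + S 0 1 * S 1 0)

theorem eval_subst (f : BForm) (S : Matrix.SpecialLinearGroup (Fin 2) ℤ) (x y : ℤ) :
    (f.subst S).eval x y = f.eval (S 0 0 * x + S 0 1 * y) (S 1 0 * x + S 1 1 * y) := by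
  simp only [eval, subst]
  ring

/-- The class `C(f)`: the orbit of `f` under `SL(2, ℤ)`. -/
def C (f : BForm) : Set BForm := Set.range f.subst

/-- The complementary form `(n, m, -k)`. -/
def compl (f : BForm) : BForm := ⟨f.n, f.m, -f.k⟩

/-- The conjugate form `(m, n, -k)`. -/
def conj (f : BForm) : BForm := ⟨f.m, f.n, -f.k⟩

/-- The adjoint form `(-n, -m, k)`. -/
def adj (f : BForm) : BForm := ⟨-f.n, -f.m, f.k⟩

/-- The antipodal form `(-n, -m, -k)`. -/
def antipodal (f : BForm) : BForm := ⟨-f.n, -f.m, -f.k⟩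

/-- The only symmetry is the complementary one, which every class has. -/
def IsAsymmetric (𝒞 : Set BForm) : Prop :=
  ∀ f ∈ 𝒞, f.compl ∈ 𝒞 ∧ f.conj ∉ 𝒞 ∧ f.adj ∉ 𝒞 ∧ f.antipodal ∉ 𝒞

/-- Closed under complement and conjugation only. -/
def IsKSymmetric (𝒞 : Set BForm) : Prop :=
  ∀ f ∈ 𝒞, f.compl ∈ 𝒞 ∧ f.conj ∈ 𝒞 ∧ f.adj ∉ 𝒞 ∧ f.antipodal ∉ 𝒞

/-- `(m + n)`-symmetric: closed under complement and adjoint only. -/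
def IsMNSymmetric (𝒞 : Set BForm) : Prop :=
  ∀ f ∈ 𝒞, f.compl ∈ 𝒞 ∧ f.conj ∉ 𝒞 ∧ f.adj ∈ 𝒞 ∧ f.antipodal ∉ 𝒞

/-- Closed under complement and antipode only. -/
def IsAntisymmetric (𝒞 : Set BForm) : Prop :=
  ∀ f ∈ 𝒞, f.compl ∈ 𝒞 ∧ f.conj ∉ 𝒞 ∧ f.adj ∉ 𝒞 ∧ f.antipodal ∈ 𝒞

/-- Closed under complement, conjugation, adjoint and antipode. -/
def IsSupersymmetric (𝒞 : Set BForm) : Prop :=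
  ∀ f ∈ 𝒞, f.compl ∈ 𝒞 ∧ f.conj ∈ 𝒞 ∧ f.adj ∈ 𝒞 ∧ f.antipodal ∈ 𝒞

end BForm

/-- The partial quotients of `a / b`, by the Euclidean algorithm. -/
def euclidCF : ℕ → ℕ → List ℕ
  | _, 0 => []
  | a, b + 1 => a / (b + 1) :: euclidCF (b + 1) (a % (b + 1))
termination_by _ b => b
decreasing_by exact Nat.mod_lt _ (Nat.succ_pos _)

/-- The (finite, regular) continued fraction `[a₁, …, a_N]` of a rational number `r > 1`;
its last element is greater than `1`. See `cfValue_ratCF`, `pos_of_mem_ratCF` and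
`one_lt_getLast_ratCF`. -/
def ratCF (r : ℚ) : List ℕ := euclidCF r.num.toNat r.den

/-- The value `a₁ + 1 / (a₂ + 1 / (⋯ + 1 / a_N))`. -/
def cfValue : List ℕ → ℚ
  | [] => 0
  | a :: l => a + 1 / cfValue l

theorem cfValue_euclidCF (a b : ℕ) : cfValue (euclidCF a b) = a / b := by
  induction b using Nat.strong_induction_on generalizing a with
  | _ b ih =>
    cases b with
    | zero => simp [euclidCF, cfValue]
    | succ b =>
      rw [euclidCF, cfValue, ih _ (Nat.mod_lt _ (Nat.succ_pos _)), one_div_div]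
      have h : ((b + 1 : ℕ) : ℚ) ≠ 0 := by positivity
      have h2 : (((b + 1) * (a / (b + 1)) + a % (b + 1) : ℕ) : ℚ) = a := by
        rw [Nat.div_add_mod]
      rw [Nat.cast_add, Nat.cast_mul] at h2
      field_simp
      linarith

theorem pos_of_mem_euclidCF (a b : ℕ) (h : b ≤ a) : ∀ c ∈ euclidCF a b, 0 < c := by
  induction b using Nat.strong_induction_on generalizing a with
  | _ b ih =>
    cases b with
    | zero => simp [euclidCF]
    | succ b =>
      have hlt := Nat.mod_lt a (Nat.succ_pos b)
      rw [euclidCF]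
      simp only [List.mem_cons, forall_eq_or_imp]
      exact ⟨Nat.div_pos h (Nat.succ_pos _), ih _ hlt _ hlt.le⟩

theorem one_lt_getLast_euclidCF (a b : ℕ) (h : b < a) (hne : euclidCF a b ≠ []) :
    1 < (euclidCF a b).getLast hne := by
  induction b using Nat.strong_induction_on generalizing a with
  | _ b ih =>
    cases b with
    | zero => simp [euclidCF] at hne
    | succ b =>
      have hlt := Nat.mod_lt a (Nat.succ_pos b)
      by_cases h0 : euclidCF (b + 1) (a % (b + 1)) = []
      · have hz : a % (b + 1) = 0 := by
          by_contra hz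
          obtain ⟨c, hc⟩ := Nat.exists_eq_succ_of_ne_zero hz
          rw [hc, euclidCF] at h0
          simp at h0
        have hd := Nat.div_add_mod a (b + 1)
        simp only [euclidCF, h0, List.getLast_singleton]
        by_contra hle
        have : a / (b + 1) ≤ 1 := by omega
        have := Nat.mul_le_mul_left (b + 1) this
        omega
      · simp only [euclidCF, List.getLast_cons h0]
        exact ih _ hlt _ hlt h0

theorem cfValue_ratCF (r : ℚ) (hr : 1 < r) : cfValue (ratCF r) = r := by
  have h : 0 ≤ r.num := Rat.num_nonneg.2 (by linarith)
  have h2 : ((r.num.toNat : ℕ) : ℚ) = (r.num : ℚ) := by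
    exact_mod_cast congrArg (Int.cast : ℤ → ℚ) (Int.toNat_of_nonneg h)
  rw [ratCF, cfValue_euclidCF, h2, Rat.num_div_den]

theorem den_lt_num_toNat (r : ℚ) (hr : 1 < r) : r.den < r.num.toNat := by
  have h : (r.den : ℚ) < r.num := by
    have hd : (0 : ℚ) < r.den := by exact_mod_cast r.den_pos
    rw [← Rat.num_div_den r, lt_div_iff₀ hd] at hr
    linarith
  have h2 : (r.den : ℤ) < r.num := by exact_mod_cast h
  omega

theorem pos_of_mem_ratCF (r : ℚ) (hr : 1 < r) : ∀ c ∈ ratCF r, 0 < c :=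
  pos_of_mem_euclidCF _ _ (den_lt_num_toNat r hr).le

theorem one_lt_getLast_ratCF (r : ℚ) (hr : 1 < r) (hne : ratCF r ≠ []) :
    1 < (ratCF r).getLast hne :=
  one_lt_getLast_euclidCF _ _ (den_lt_num_toNat r hr) hne

/-- `[a₁, …, a_N] ↦ [a₁, …, a_N - 1, 1]`. -/
def splitLast (l : List ℕ) : List ℕ := l.dropLast ++ [l.getLastD 0 - 1, 1]

/-- The odd continued fraction of a rational number `r > 1`. -/
def oddCF (r : ℚ) : List ℕ := if Odd (ratCF r).length then ratCF r else splitLast (ratCF r)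

/-- The even continued fraction of a rational number `r > 1`. -/
def evenCF (r : ℚ) : List ℕ := if Even (ratCF r).length then ratCF r else splitLast (ratCF r)

/-! Conjugation, adjoint and antipode permute classes, so each symmetry need only be tested on `f =
(m, 0, k)` (`forall_mem_C_iff`). This form has two rational isotropic lines; an equivalence between
two such forms either fixes the line `x = 0`, keeping `k`, or uses the other one, changing its sign.
With `m = gq`, `k = gp` and `p`, `q` coprime, this gives: antipodal iff `k ∣ 2m`, conjugate iff `p ∣
q² - 1`, adjoint iff `p ∣ q² + 1`.

For the continued fraction side, the product of the matrices `(a 1; 1 0)` has first column `(p, q)`,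
determinant `(-1)^N`, and is transposed by reversal. With `q'` its upper right entry, `q q' ≡
(-1)^(N+1) mod p`, and a palindrome means `q = q'` (`palindrome_iff_dvd`): odd length matches the
conjugate, even length the adjoint. -/

namespace BForm

/-! ### The action of `SL(2, ℤ)` and the symmetries of a class -/

open Matrix

/-- The element `(a b; c d)` of `SL(2, ℤ)`. -/
def slMk (a b c d : ℤ) (h : a * d - b * c = 1) : SpecialLinearGroup (Fin 2) ℤ :=
  ⟨!![a, b; c, d], by rw [det_fin_two_of, h]⟩

theorem sl_det (S : SpecialLinearGroup (Fin 2) ℤ) : S 0 0 * S 1 1 - S 0 1 * S 1 0 = 1 := by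
  have h := S.det_coe
  rwa [det_fin_two] at h

theorem subst_mul (f : BForm) (S T : SpecialLinearGroup (Fin 2) ℤ) :
    f.subst (S * T) = (f.subst S).subst T := by
  ext <;> (simp [subst, Matrix.mul_apply, Fin.sum_univ_two]; ring)

theorem subst_one (f : BForm) : f.subst 1 = f := by
  ext <;> simp [subst]

theorem subst_mem_C_iff (f₀ f : BForm) (S : SpecialLinearGroup (Fin 2) ℤ) :
    f.subst S ∈ C f₀ ↔ f ∈ C f₀ := by
  constructor
  · rintro ⟨T, hT⟩
    exact ⟨T * S⁻¹, by rw [subst_mul, hT, ← subst_mul, mul_inv_cancel, subst_one]⟩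
  · rintro ⟨T, rfl⟩
    exact ⟨T * S, subst_mul _ _ _⟩

theorem self_mem_C (f : BForm) : f ∈ C f := ⟨1, subst_one f⟩

theorem compl_eq_subst (f : BForm) : f.compl = f.subst (slMk 0 (-1) 1 0 (by norm_num)) := by
  ext <;> simp [compl, subst, slMk]

theorem compl_mem_C_iff (f₀ f : BForm) : f.compl ∈ C f₀ ↔ f ∈ C f₀ := by
  rw [compl_eq_subst, subst_mem_C_iff]

/-- Up to sign, each of the three operations is composition with a fixed matrix of determinant `±1`,
which normalises `SL(2, ℤ)`; the matrix on the right is the conjugate of `S`. -/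
theorem conj_subst (f : BForm) (S : SpecialLinearGroup (Fin 2) ℤ) :
    (f.subst S).conj = f.conj.subst
      (slMk (S 0 0) (-S 0 1) (-S 1 0) (S 1 1) (by linear_combination sl_det S)) := by
  ext <;> simp [conj, subst, slMk] <;> ring

theorem adj_subst (f : BForm) (S : SpecialLinearGroup (Fin 2) ℤ) :
    (f.subst S).adj = f.adj.subst
      (slMk (S 1 1) (-S 1 0) (-S 0 1) (S 0 0) (by linear_combination sl_det S)) := by
  ext <;> simp [adj, subst, slMk] <;> ring

theorem antipodal_subst (f : BForm) (S : SpecialLinearGroup (Fin 2) ℤ) :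
    (f.subst S).antipodal = f.antipodal.subst
      (slMk (S 1 1) (S 1 0) (S 0 1) (S 0 0) (by linear_combination sl_det S)) := by
  ext <;> simp [antipodal, subst, slMk] <;> ring

theorem conj_mem_C_iff {f₀ f : BForm} (hf : f ∈ C f₀) : f.conj ∈ C f₀ ↔ f₀.conj ∈ C f₀ := by
  obtain ⟨S, rfl⟩ := hf
  rw [conj_subst, subst_mem_C_iff]

theorem adj_mem_C_iff {f₀ f : BForm} (hf : f ∈ C f₀) : f.adj ∈ C f₀ ↔ f₀.adj ∈ C f₀ := by
  obtain ⟨S, rfl⟩ := hf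
  rw [adj_subst, subst_mem_C_iff]

theorem antipodal_mem_C_iff {f₀ f : BForm} (hf : f ∈ C f₀) :
    f.antipodal ∈ C f₀ ↔ f₀.antipodal ∈ C f₀ := by
  obtain ⟨S, rfl⟩ := hf
  rw [antipodal_subst, subst_mem_C_iff]

theorem forall_mem_C_iff (f₀ : BForm) (P : Prop → Prop → Prop → Prop) :
    (∀ f ∈ C f₀, f.compl ∈ C f₀ ∧ P (f.conj ∈ C f₀) (f.adj ∈ C f₀) (f.antipodal ∈ C f₀)) ↔
      P (f₀.conj ∈ C f₀) (f₀.adj ∈ C f₀) (f₀.antipodal ∈ C f₀) := by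
  constructor
  · exact fun h => (h f₀ (self_mem_C f₀)).2
  · intro h f hf
    rw [conj_mem_C_iff hf, adj_mem_C_iff hf, antipodal_mem_C_iff hf]
    exact ⟨(compl_mem_C_iff f₀ f).2 hf, h⟩

/-! ### Equivalence of forms with `n = 0` -/

/-- Two forms `(m, 0, k)` and `(m', 0, k)` with `k ≠ 0` are equivalent iff `m ≡ m' mod k`. -/
theorem mem_C_same_sign_iff {m m' k : ℤ} (hk : k ≠ 0) :
    (⟨m', 0, k⟩ : BForm) ∈ C ⟨m, 0, k⟩ ↔ k ∣ m' - m := by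
  constructor
  · rintro ⟨S, hS⟩
    have hd := sl_det S
    simp only [subst, BForm.mk.injEq] at hS
    obtain ⟨h1, h2, h3⟩ := hS
    have h2' : S 0 1 * (m * S 0 1 + k * S 1 1) = 0 := by linear_combination h2
    rcases mul_eq_zero.1 h2' with hb | hb
    · have had : S 0 0 * S 1 1 = 1 := by rw [hb] at hd; linarith
      have ha : S 0 0 * S 0 0 = 1 := by
        rcases Int.eq_one_or_neg_one_of_mul_eq_one had with h | h <;> rw [h] <;> norm_num
      exact ⟨S 0 0 * S 1 0, by linear_combination -h1 + m * ha⟩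
    -- The second column of `S` lies on the other isotropic line, which would force `k = -k`.
    · have : 2 * k = 0 := by
        linear_combination -h3 + 2 * S 0 0 * hb - k * hd
      omega
  · rintro ⟨e, he⟩
    refine ⟨slMk 1 0 e 1 (by norm_num), ?_⟩
    ext <;> simp [subst, slMk]
    linarith

/-- The forms `(g q, 0, g p)` and `(g s, 0, -g p)` with `p`, `q` coprime are equivalent iff
`q s ≡ 1 mod p`. -/
theorem mem_C_opposite_sign_iff {g p q s : ℤ} (hg : g ≠ 0) (hp : p ≠ 0) (hpq : IsCoprime p q) :
    (⟨g * s, 0, -(g * p)⟩ : BForm) ∈ C ⟨g * q, 0, g * p⟩ ↔ p ∣ q * s - 1 := by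
  constructor
  · rintro ⟨S, hS⟩
    have hd := sl_det S
    simp only [subst, BForm.mk.injEq] at hS
    obtain ⟨h1, h2, h3⟩ := hS
    have h1' : S 0 0 * (q * S 0 0 + p * S 1 0) = s := by
      apply mul_left_cancel₀ hg
      linear_combination h1
    have h2' : g * (S 0 1 * (q * S 0 1 + p * S 1 1)) = 0 := by linear_combination h2
    rcases mul_eq_zero.1 ((mul_eq_zero.1 h2').resolve_left hg) with hb | hb
    · have : 2 * (g * p) = 0 := by
        rw [hb] at hd h3
        linear_combination h3 - g * p * hd
      simp [hg, hp] at this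
    -- By coprimality the second column is `t (p, -q)`, and the determinant forces `t = ±1`. The
    -- converse takes `t = 1`.
    · obtain ⟨t, ht⟩ : p ∣ S 0 1 :=
        hpq.dvd_of_dvd_mul_left ⟨-S 1 1, by linear_combination hb⟩
      have hdt : S 1 1 = -(q * t) := by
        apply mul_left_cancel₀ hp
        rw [ht] at hb
        linear_combination hb
      rw [ht, hdt] at hd
      have ht1 : t * -(q * S 0 0 + p * S 1 0) = 1 := by linear_combination hd
      have htt : t * t = 1 := by
        rcases Int.eq_one_or_neg_one_of_mul_eq_one ht1 with h | h <;> rw [h] <;> norm_num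
      have hw : q * S 0 0 + p * S 1 0 = -t := by
        linear_combination (-t) * ht1 - (q * S 0 0 + p * S 1 0) * htt
      rw [hw] at h1'
      exact ⟨t * S 1 0, by linear_combination -q * h1' - t * hw + htt⟩
  · rintro ⟨e, he⟩
    refine ⟨slMk (-s) p e (-q) (by linear_combination he), ?_⟩
    ext <;> simp [subst, slMk]
    · linear_combination g * s * he
    · ring
    · linear_combination (-g * p) * he

end BForm

/-! ### Continued fractions and palindromes -/

/-- The product of the matrices `(a 1; 1 0)` over the partial quotients. -/
def cfMatrix (l : List ℕ) : Matrix (Fin 2) (Fin 2) ℤ :=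
  (l.map fun a : ℕ => !![(a : ℤ), 1; 1, 0]).prod

theorem cfMatrix_cons (a : ℕ) (l : List ℕ) :
    cfMatrix (a :: l) = !![(a : ℤ), 1; 1, 0] * cfMatrix l := by
  simp [cfMatrix]

theorem cfMatrix_reverse (l : List ℕ) : cfMatrix l.reverse = (cfMatrix l).transpose := by
  rw [cfMatrix, cfMatrix, Matrix.transpose_list_prod, List.map_map, List.map_reverse]
  congr 3
  ext a i j
  fin_cases i <;> fin_cases j <;> rfl

theorem det_cfMatrix (l : List ℕ) : (cfMatrix l).det = (-1) ^ l.length := by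
  induction l with
  | nil => simp [cfMatrix]
  | cons a l ih => rw [cfMatrix_cons, Matrix.det_mul, ih, Matrix.det_fin_two_of]; simp [pow_succ]

theorem cfMatrix_nonneg (l : List ℕ) (h : ∀ c ∈ l, 0 < c) :
    0 < cfMatrix l 0 0 ∧ 0 ≤ cfMatrix l 1 0 ∧ (l ≠ [] → 0 < cfMatrix l 1 0) := by
  induction l with
  | nil => simp [cfMatrix]
  | cons a l ih =>
    obtain ⟨h1, h2, -⟩ := ih fun c hc => h c (List.mem_cons_of_mem _ hc)
    have ha : (0 : ℤ) < a := by exact_mod_cast h a List.mem_cons_self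
    rw [cfMatrix_cons]
    simp only [Matrix.mul_apply, Fin.sum_univ_two]
    simp
    exact ⟨by positivity, h1.le, h1⟩

theorem cfValue_eq_div (l : List ℕ) (h : ∀ c ∈ l, 0 < c) :
    cfValue l = cfMatrix l 0 0 / cfMatrix l 1 0 := by
  induction l with
  -- The value `0` of the empty list agrees with `1 / 0 = 0`.
  | nil => simp [cfMatrix, cfValue]
  | cons a l ih =>
    have hl : ∀ c ∈ l, 0 < c := fun c hc => h c (List.mem_cons_of_mem _ hc)
    have h1 : (cfMatrix l 0 0 : ℚ) ≠ 0 := by exact_mod_cast (cfMatrix_nonneg l hl).1.ne'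
    rw [cfValue, ih hl, cfMatrix_cons, one_div_div]
    simp [Matrix.mul_apply, Fin.sum_univ_two]
    field_simp

theorem one_le_cfValue (l : List ℕ) (h : ∀ c ∈ l, 0 < c) (hl : l ≠ []) :
    1 ≤ cfValue l ∧ (l ≠ [1] → 1 < cfValue l) := by
  induction l with
  | nil => simp at hl
  | cons a l ih =>
    have ha : (1 : ℚ) ≤ a := by exact_mod_cast h a List.mem_cons_self
    rw [cfValue]
    rcases eq_or_ne l [] with rfl | hne
    · simp only [cfValue, div_zero, add_zero]
      refine ⟨ha, fun h1 => lt_of_le_of_ne ha fun h2 => h1 ?_⟩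
      have : a = 1 := by exact_mod_cast h2.symm
      rw [this]
    · have h1 := (ih (fun c hc => h c (List.mem_cons_of_mem _ hc)) hne).1
      have h2 : 0 < 1 / cfValue l := by positivity
      exact ⟨by linarith, fun _ => by linarith⟩

/-- A last entry `1` is allowed, so `[a + 1]` and `[a, 1]` agree in value; fixing the length
restores uniqueness. -/
theorem eq_of_cfValue_eq (l l' : List ℕ) (h : ∀ c ∈ l, 0 < c) (h' : ∀ c ∈ l', 0 < c)
    (hlen : l.length = l'.length) (hv : cfValue l = cfValue l') : l = l' := by
  induction l generalizing l' with
  | nil => exact (List.length_eq_zero_iff.1 hlen.symm).symm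
  | cons a l ih =>
    obtain _ | ⟨b, l'⟩ := l'
    · simp at hlen
    have hl : ∀ c ∈ l, 0 < c := fun c hc => h c (List.mem_cons_of_mem _ hc)
    have hl' : ∀ c ∈ l', 0 < c := fun c hc => h' c (List.mem_cons_of_mem _ hc)
    have hlen' : l.length = l'.length := by simpa using hlen
    simp only [cfValue] at hv
    rcases eq_or_ne l [] with rfl | hne
    · obtain rfl : l' = [] := List.length_eq_zero_iff.1 hlen'.symm
      simp only [cfValue, div_zero, add_zero, Nat.cast_inj] at hv
      rw [hv]
    · have hne' : l' ≠ [] := by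
        rintro rfl
        exact hne (List.length_eq_zero_iff.1 hlen')
      have hx := (one_le_cfValue l hl hne).1
      have hy := (one_le_cfValue l' hl' hne').1
      have hx0 : 0 < 1 / cfValue l := by positivity
      have hy0 : 0 < 1 / cfValue l' := by positivity
      have hx1 : 1 / cfValue l ≤ 1 := by rw [div_le_one (by linarith)]; exact hx
      have hy1 : 1 / cfValue l' ≤ 1 := by rw [div_le_one (by linarith)]; exact hy
      -- Both fractional tails lie in `(0, 1]`, which is enough to force equal heads.
      have h1 : (a : ℚ) < ((b + 1 : ℕ) : ℚ) := by push_cast; linarith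
      have h2 : (b : ℚ) < ((a + 1 : ℕ) : ℚ) := by push_cast; linarith
      have hab : a = b := by
        have := Nat.cast_lt.1 h1
        have := Nat.cast_lt.1 h2
        omega
      subst hab
      rw [ih l' hl hl' hlen' (by simpa using hv)]

/-- If `r = [a₁, …, a_N] > 1` is `p / q` in lowest terms, then the continued fraction is
palindromic iff `q² ≡ (-1)^(N+1) mod p`. -/
theorem palindrome_iff_dvd (r : ℚ) (hr : 1 < r) (l : List ℕ) (h : ∀ c ∈ l, 0 < c)
    (hv : cfValue l = r) :
    l.Palindrome ↔ r.num ∣ (r.den : ℤ) * r.den + (-1) ^ l.length := by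
  have hne : l ≠ [] := by
    rintro rfl
    simp only [cfValue] at hv
    linarith
  obtain ⟨hp, -, hq⟩ := cfMatrix_nonneg l h
  specialize hq hne
  have hdet : cfMatrix l 0 0 * cfMatrix l 1 1 - cfMatrix l 0 1 * cfMatrix l 1 0
      = (-1) ^ l.length := by rw [← det_cfMatrix, Matrix.det_fin_two]
  have hsq : ((-1 : ℤ) ^ l.length) * (-1) ^ l.length = 1 := by
    rw [← mul_pow]; norm_num
  have hcop : IsCoprime (cfMatrix l 0 0) (cfMatrix l 1 0) :=
    ⟨(-1) ^ l.length * cfMatrix l 1 1, -(-1) ^ l.length * cfMatrix l 0 1, by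
      linear_combination (-1) ^ l.length * hdet + hsq⟩
  have hrat := hv.symm.trans (cfValue_eq_div l h)
  have hnum : r.num = cfMatrix l 0 0 := by
    rw [hrat, Rat.num_div_eq_of_coprime hq (Int.isCoprime_iff_nat_coprime.1 hcop)]
  have hden : (r.den : ℤ) = cfMatrix l 1 0 := by
    rw [hrat, Rat.den_div_eq_of_coprime hq (Int.isCoprime_iff_nat_coprime.1 hcop)]
  have hlt : cfMatrix l 1 0 < cfMatrix l 0 0 := by
    rw [hrat, one_lt_div (by exact_mod_cast hq)] at hr
    exact_mod_cast hr
  rw [hnum, hden]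
  have hrev : ∀ c ∈ l.reverse, 0 < c := fun c hc => h c (List.mem_reverse.1 hc)
  have hrev10 : cfMatrix l.reverse 1 0 = cfMatrix l 0 1 := by rw [cfMatrix_reverse]; rfl
  have hrev00 : cfMatrix l.reverse 0 0 = cfMatrix l 0 0 := by rw [cfMatrix_reverse]; rfl
  constructor
  · intro hpal
    rw [hpal.reverse_eq] at hrev10
    exact ⟨cfMatrix l 1 1, by linear_combination -hdet + cfMatrix l 1 0 * hrev10⟩
  · rintro ⟨e, he⟩
    have hne' : l.reverse ≠ [] := by simpa using hne
    have hq' : 0 < cfMatrix l 0 1 := hrev10 ▸ (cfMatrix_nonneg _ hrev).2.2 hne'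
    have hval := cfValue_eq_div _ hrev
    have hlt' : cfMatrix l 0 1 < cfMatrix l 0 0 := by
      have h1 : l.reverse ≠ [1] := by
        intro h1
        rw [List.reverse_eq_iff] at h1
        rw [h1] at hv
        norm_num [cfValue] at hv
        linarith
      have h2 := (one_le_cfValue _ hrev hne').2 h1
      rw [hval, hrev10, hrev00, one_lt_div (by exact_mod_cast hq')] at h2
      exact_mod_cast h2
    -- Both `q²` and `q q'` are `(-1)^(N+1)` mod `p`; cancel `q`. As `0 < q, q' < p`, they coincide,
    -- so the reversed list has the same value and length.
    have hdvd : cfMatrix l 0 0 ∣ cfMatrix l 1 0 - cfMatrix l 0 1 :=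
      hcop.dvd_of_dvd_mul_left ⟨e - cfMatrix l 1 1, by linear_combination he + hdet⟩
    have heq : cfMatrix l 1 0 - cfMatrix l 0 1 = 0 :=
      Int.eq_zero_of_abs_lt_dvd hdvd (abs_lt.2 ⟨by linarith, by linarith⟩)
    apply List.Palindrome.of_reverse_eq
    refine eq_of_cfValue_eq _ _ hrev h (List.length_reverse) ?_
    rw [hval, hrev10, hrev00, cfValue_eq_div l h, sub_eq_zero.1 heq]

theorem cfValue_append_split (l : List ℕ) (a : ℕ) :
    cfValue (l ++ [a, 1]) = cfValue (l ++ [a + 1]) := by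
  induction l with
  | nil => simp [cfValue]
  | cons b l ih => simp only [List.cons_append, cfValue, ih]

theorem splitLast_spec (r : ℚ) (hr : 1 < r) :
    (∀ c ∈ splitLast (ratCF r), 0 < c) ∧ cfValue (splitLast (ratCF r)) = r ∧
      (splitLast (ratCF r)).length = (ratCF r).length + 1 := by
  have hv := cfValue_ratCF r hr
  have hne : ratCF r ≠ [] := by
    intro h
    rw [h, cfValue] at hv
    linarith
  have hlast := one_lt_getLast_ratCF r hr hne
  have hpos := pos_of_mem_ratCF r hr
  have hD : (ratCF r).getLastD 0 = (ratCF r).getLast hne := by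
    rw [List.getLastD_eq_getLast?, List.getLast?_eq_getLast_of_ne_nil hne, Option.getD_some]
  rw [splitLast, hD]
  refine ⟨?_, ?_, ?_⟩
  · intro c hc
    rw [List.mem_append] at hc
    rcases hc with hc | hc
    · exact hpos c (List.dropLast_subset _ hc)
    · simp only [List.mem_cons, List.not_mem_nil, or_false] at hc
      omega
  · rw [cfValue_append_split, Nat.sub_add_cancel hlast.le, List.dropLast_append_getLast hne, hv]
  · have := List.length_pos_iff.2 hne
    simp only [List.length_append, List.length_dropLast, List.length_cons, List.length_nil]
    omega

theorem oddCF_palindrome_iff (r : ℚ) (hr : 1 < r) :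
    (oddCF r).Palindrome ↔ r.num ∣ (r.den : ℤ) * r.den - 1 := by
  obtain ⟨h1, h2, h3⟩ := splitLast_spec r hr
  rw [oddCF]
  split_ifs with h
  · rw [palindrome_iff_dvd r hr _ (pos_of_mem_ratCF r hr) (cfValue_ratCF r hr), h.neg_one_pow]
    rfl
  · rw [palindrome_iff_dvd r hr _ h1 h2, h3, (Nat.not_odd_iff_even.1 h).add_one.neg_one_pow]
    rfl

theorem evenCF_palindrome_iff (r : ℚ) (hr : 1 < r) :
    (evenCF r).Palindrome ↔ r.num ∣ (r.den : ℤ) * r.den + 1 := by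
  obtain ⟨h1, h2, h3⟩ := splitLast_spec r hr
  rw [evenCF]
  split_ifs with h
  · rw [palindrome_iff_dvd r hr _ (pos_of_mem_ratCF r hr) (cfValue_ratCF r hr), h.neg_one_pow]
  · rw [palindrome_iff_dvd r hr _ h1 h2, h3, (Nat.not_even_iff_odd.1 h).add_one.neg_one_pow]

/-! ### Symmetries of `C(m, 0, k)` and the classification -/

namespace BForm

theorem antipodal_mem_C_iff_dvd {m k : ℤ} (hk : k ≠ 0) :
    antipodal ⟨m, 0, k⟩ ∈ C ⟨m, 0, k⟩ ↔ k ∣ 2 * m := by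
  rw [← compl_mem_C_iff]
  simp only [compl, antipodal, neg_zero, neg_neg]
  rw [mem_C_same_sign_iff hk, ← dvd_neg]
  ring_nf

theorem conj_mem_C_iff_dvd {g p q : ℤ} (hg : g ≠ 0) (hp : p ≠ 0) (hpq : IsCoprime p q) :
    conj ⟨g * q, 0, g * p⟩ ∈ C ⟨g * q, 0, g * p⟩ ↔ p ∣ q * q - 1 :=
  mem_C_opposite_sign_iff hg hp hpq

theorem adj_mem_C_iff_dvd {g p q : ℤ} (hg : g ≠ 0) (hp : p ≠ 0) (hpq : IsCoprime p q) :
    adj ⟨g * q, 0, g * p⟩ ∈ C ⟨g * q, 0, g * p⟩ ↔ p ∣ q * q + 1 := by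
  rw [← compl_mem_C_iff]
  simp only [compl, adj, neg_zero]
  rw [← mul_neg, mem_C_opposite_sign_iff hg hp hpq, ← dvd_neg]
  ring_nf

theorem dvd_two_mul_iff {m k : ℤ} (hm : 0 ≤ m) (hmk : m < |k|) :
    k ∣ 2 * m ↔ m = 0 ∨ 2 * m = |k| := by
  rw [← abs_dvd]
  constructor
  · rintro ⟨e, he⟩
    have h0 : 0 < |k| := by omega
    have h1 : 0 ≤ e := by
      by_contra h
      nlinarith
    have h2 : e < 2 := by
      by_contra h
      nlinarith
    interval_cases e <;> omega
  · rintro (h | h)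
    · simp [h]
    · rw [h]

/-- The symmetries of `C(m, 0, k)` in terms of the continued fractions of `|k| / m`. -/
theorem conj_adj_mem_C_iff_palindrome {m k : ℤ} (hm : 0 < m) (hmk : m < |k|) :
    (conj ⟨m, 0, k⟩ ∈ C ⟨m, 0, k⟩ ↔ (oddCF (((|k| : ℤ) : ℚ) / (m : ℚ))).Palindrome) ∧
    (adj ⟨m, 0, k⟩ ∈ C ⟨m, 0, k⟩ ↔ (evenCF (((|k| : ℤ) : ℚ) / (m : ℚ))).Palindrome) := by
  have hr : (1 : ℚ) < ((|k| : ℤ) : ℚ) / (m : ℚ) := by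
    rw [one_lt_div (by exact_mod_cast hm)]
    exact_mod_cast hmk
  rw [oddCF_palindrome_iff _ hr, evenCF_palindrome_iff _ hr]
  obtain ⟨g, hgk, hgm⟩ := Rat.exists_eq_mul_div_num_and_eq_mul_div_den |k| hm.ne'
  set r : ℚ := ((|k| : ℤ) : ℚ) / (m : ℚ) with hrdef
  have hg : g ≠ 0 := by
    rintro rfl
    simp at hgm
    omega
  have hp : r.num ≠ 0 := (Rat.num_pos.2 (by linarith)).ne'
  have hcop : IsCoprime r.num r.den := r.isCoprime_num_den
  rcases abs_choice k with h | h
  · rw [h] at hgk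
    rw [hgk, hgm]
    exact ⟨conj_mem_C_iff_dvd hg hp hcop, adj_mem_C_iff_dvd hg hp hcop⟩
  -- For negative `k` the sign is absorbed into `p`, which divisibility ignores.
  · have hk : k = g * -r.num := by linarith
    rw [hk, hgm, ← neg_dvd (a := r.num), ← neg_dvd (a := r.num)]
    exact ⟨conj_mem_C_iff_dvd hg (neg_ne_zero.2 hp) hcop.neg_left,
      adj_mem_C_iff_dvd hg (neg_ne_zero.2 hp) hcop.neg_left⟩

theorem conj_adj (f : BForm) : f.conj.adj = f.antipodal := by
  simp [conj, adj, antipodal]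

theorem conj_antipodal (f : BForm) : f.conj.antipodal = f.adj := by
  simp [conj, adj, antipodal]

end BForm

theorem mainTheorem11 (m k : ℤ) (hm : 0 ≤ m) (hmk : m < |k|) :
    -- (i)
    (BForm.IsSupersymmetric (BForm.C ⟨m, 0, k⟩) ↔ m = 0 ∨ (Even k ∧ 2 * m = |k|)) ∧
    (2 * m = |k| → 4 ∣ BForm.disc ⟨m, 0, k⟩) ∧
    -- (ii)
    (0 < m → 2 * m ≠ |k| →
      (BForm.IsMNSymmetric (BForm.C ⟨m, 0, k⟩) ↔
        (evenCF (((|k| : ℤ) : ℚ) / (m : ℚ))).Palindrome)) ∧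
    -- (iii)
    (0 < m → 2 * m ≠ |k| →
      (BForm.IsKSymmetric (BForm.C ⟨m, 0, k⟩) ↔
        (oddCF (((|k| : ℤ) : ℚ) / (m : ℚ))).Palindrome)) ∧
    -- (iv)
    ¬ BForm.IsAntisymmetric (BForm.C ⟨m, 0, k⟩) ∧
    -- (v)
    (0 < m →
      (BForm.IsAsymmetric (BForm.C ⟨m, 0, k⟩) ↔
        ¬ (oddCF (((|k| : ℤ) : ℚ) / (m : ℚ))).Palindrome ∧
        ¬ (evenCF (((|k| : ℤ) : ℚ) / (m : ℚ))).Palindrome)) := by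
  have hk : k ≠ 0 := abs_pos.1 (hm.trans_lt hmk)
  set f : BForm := ⟨m, 0, k⟩ with hf
  have hD : f.antipodal ∈ f.C ↔ m = 0 ∨ 2 * m = |k| :=
    (BForm.antipodal_mem_C_iff_dvd hk).trans (BForm.dvd_two_mul_iff hm hmk)
  have hAB : f.conj ∈ f.C → f.adj ∈ f.C → f.antipodal ∈ f.C := fun hA hB => by
    rwa [← BForm.conj_adj, BForm.adj_mem_C_iff hA]
  have hAD : f.conj ∈ f.C → f.antipodal ∈ f.C → f.adj ∈ f.C := fun hA hD => by
    rwa [← BForm.conj_antipodal, BForm.antipodal_mem_C_iff hA]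
  -- This excludes antisymmetry: if `m = 0` the conjugate is the complement of `f`, and if `2m =
  -- |k|` then `q = 1`, `p = ±2`, so `p ∣ q² - 1` trivially.
  have hA : f.antipodal ∈ f.C → f.conj ∈ f.C := by
    rw [hD]
    rintro (h | h)
    · rw [← BForm.compl_mem_C_iff]
      simpa [hf, h, BForm.conj, BForm.compl] using f.self_mem_C
    · have hm0 : m ≠ 0 := by
        rintro rfl
        omega
      obtain ⟨p, hp, hkp⟩ : ∃ p : ℤ, (p = 2 ∨ p = -2) ∧ k = m * p := by
        rcases abs_choice k with h' | h'
        · exact ⟨2, Or.inl rfl, by linarith⟩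
        · exact ⟨-2, Or.inr rfl, by linarith⟩
      have hp0 : p ≠ 0 := by omega
      have := (BForm.conj_mem_C_iff_dvd (q := 1) hm0 hp0 isCoprime_one_right).2 (by norm_num)
      rwa [mul_one, ← hkp] at this
  have hpal := fun h : 0 < m => BForm.conj_adj_mem_C_iff_palindrome h hmk
  have hsup := BForm.forall_mem_C_iff f fun A B D => A ∧ B ∧ D
  have hmn := BForm.forall_mem_C_iff f fun A B D => ¬A ∧ B ∧ ¬D
  have hks := BForm.forall_mem_C_iff f fun A B D => A ∧ ¬B ∧ ¬D
  have hanti := BForm.forall_mem_C_iff f fun A B D => ¬A ∧ ¬B ∧ D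
  have hasym := BForm.forall_mem_C_iff f fun A B D => ¬A ∧ ¬B ∧ ¬D
  simp only [BForm.IsSupersymmetric, BForm.IsMNSymmetric, BForm.IsKSymmetric,
    BForm.IsAntisymmetric, BForm.IsAsymmetric]
  rw [hsup, hmn, hks, hanti, hasym]
  clear hsup hmn hks hanti hasym
  have heven : 2 * m = |k| → Even k := fun h => even_abs.1 (h ▸ even_two_mul m)
  refine ⟨?_, fun h => ?_, fun h h2 => ?_, fun h h2 => ?_, fun h => h.1 (hA h.2.2), fun h => ?_⟩
  · rw [← and_iff_right_of_imp heven] at hD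
    rw [← hD]
    exact ⟨fun h => h.2.2, fun h => ⟨hA h, hAD (hA h) h, h⟩⟩
  · obtain ⟨c, rfl⟩ := heven h
    exact ⟨c ^ 2, by simp only [hf, BForm.disc]; ring⟩
  · have hnD : f.antipodal ∉ f.C := fun hd => (hD.1 hd).elim h.ne' h2
    rw [← (hpal h).2]
    exact ⟨fun h => h.2.1, fun h => ⟨fun h' => hnD (hAB h' h), h, hnD⟩⟩
  · have hnD : f.antipodal ∉ f.C := fun hd => (hD.1 hd).elim h.ne' h2
    rw [← (hpal h).1]
    exact ⟨fun h => h.1, fun h => ⟨h, fun h' => hnD (hAB h h'), hnD⟩⟩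
  · rw [← (hpal h).1, ← (hpal h).2]
    exact ⟨fun h => ⟨h.1, h.2.1⟩, fun h => ⟨h.1, h.2, fun hd => h.1 (hA hd)⟩⟩
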